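/- Let $m\ge 1$ be an integer and let $H$ be a subgroup of $(\mathbb{Z}/m\mathbb{Z})^{\times}$. Let $\mathcal{A}$ be the set of rational primes $p$ whose residue class modulo $m$ lies in $H$. Then $\mathcal{A}$ has polar density $|H|/\varphi(m)$, where $\varphi$ is Euler's totient function. Here, for a number field $K$ and a set $\mathcal{A}$ of nonzero prime ideals of its ring of integers $\mathcal{O}_K$, the partial Dedekind zeta function is $\zeta_{K,\mathcal{A}}(s)=\prod_{\mathfrak{p}\in\mathcal{A}}\left(1-N(\mathfrak{p})^{-s}\right)^{-1}$ for $\operatorname{Re}(s)>1$, and $\mathcal{A}$ is said to have polar density $k/n$ if, for some integers $n\ge 1$ and $k\ge 0$, the power $\zeta_{K,\mathcal{A}}^{\,n}$ extends to a meromorphic function in a neighbourhood of $s=1$ with a pole of order $k$ at $s=1$ (for $k=0$: holomorphic and non-zero at $s=1$). A set of rational primes is regarded as a set of primes of $\mathcal{O}_K$ with $K=\mathbb{Q}$. -/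

import Mathlib

open scoped NumberField

open IsDedekindDomain

/-- The partial Dedekind zeta function of a set `A` of (nonzero) primes of `𝓞 K`, given for
`1 < re s` by its absolutely convergent Euler product `∏_{𝔭 ∈ A} (1 - N(𝔭)^(-s))⁻¹`. -/
noncomputable def partialDedekindZeta {K : Type*} [Field K] [NumberField K]
    (A : Set (HeightOneSpectrum (𝓞 K))) (s : ℂ) : ℂ :=
  ∏' 𝔭 : A, (1 - (Ideal.absNorm 𝔭.1.asIdeal : ℂ) ^ (-s))⁻¹

/-- `A` has polar density `δ`: for some integer `n ≥ 1`, the `n`-th power of the partial zeta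
function of `A` (a function on the half-plane `1 < re s`) extends to a meromorphic function on a
neighbourhood of `1` which has a pole of order `k` at `1`, and `δ = k / n`.
Here `k = 0` means that the extension has neither a pole nor a zero at `1`. -/
def HasPolarDensity {K : Type*} [Field K] [NumberField K]
    (A : Set (HeightOneSpectrum (𝓞 K))) (δ : ℝ) : Prop :=
  ∃ n k : ℕ, 1 ≤ n ∧ δ = (k : ℝ) / (n : ℝ) ∧
    ∃ (U : Set ℂ) (F : ℂ → ℂ), IsOpen U ∧ (1 : ℂ) ∈ U ∧ MeromorphicOn F U ∧
      (∀ s ∈ U, 1 < s.re → F s = partialDedekindZeta A s ^ n) ∧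
      meromorphicOrderAt F 1 = ((-(k : ℤ) : ℤ) : WithTop ℤ)

/-- The set of rational primes (as prime ideals of `𝓞 ℚ`, the ring of rational integers) whose
residue class modulo `m` lies in the subgroup `H` of `(ℤ/mℤ)ˣ`. -/
def primesWithResidueIn {m : ℕ} (H : Subgroup (ZMod m)ˣ) : Set (HeightOneSpectrum (𝓞 ℚ)) :=
  {v | ∃ p : ℕ, p.Prime ∧ v.asIdeal = Ideal.span {(p : 𝓞 ℚ)} ∧ ∃ u ∈ H, (u : ZMod m) = (p : ZMod m)}

/-! Let X be the group of Dirichlet characters modulo m trivial on H; by duality it has φ(m)/|H|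
elements (`card_charactersTrivialOn`). Compare ∏_{χ ∈ X} L(s, χ) with the |X|-th power of the
partial zeta function, for Re s > 1. At primes with class in H the Euler factors agree. At every
other prime the sum of χ(p) over X vanishes, so the inverse Euler factor has no linear term and is 1
+ O(p^(-2 Re s)). The product of these corrections is holomorphic and non-zero for Re s > 3/4. Hence
the power equals ∏ L(s, χ) times a harmless factor (`prod_LFunction_mul_complementaryProduct`). The
trivial character gives a simple pole at 1, and L(1, χ) ≠ 0 for the others, so k = 1 and n = |X|. -/

/-- To first order, `∏ (1 - a i)` is `1 - ∑ a i`, with an error that is quadratic in the size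
of the `a i`. -/
lemma norm_prod_one_sub_sub_one_add_sum_le {ι : Type*} (s : Finset ι) (a : ι → ℂ) {r : ℝ}
    (hr0 : 0 ≤ r) (hr1 : r ≤ 1) (h : ∀ i ∈ s, ‖a i‖ ≤ r) :
    ‖∏ i ∈ s, (1 - a i) - 1 + ∑ i ∈ s, a i‖ ≤ 4 ^ s.card * r ^ 2 := by
  classical
  induction s using Finset.induction_on with
  | empty => simp; positivity
  | insert j t hj ih =>
    have ih := ih fun i hi ↦ h i (Finset.mem_insert_of_mem hi)
    have hj' := h j (Finset.mem_insert_self j t)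
    rw [Finset.prod_insert hj, Finset.sum_insert hj, Finset.card_insert_of_notMem hj]
    set P := ∏ i ∈ t, (1 - a i)
    set S := ∑ i ∈ t, a i
    have hS : ‖S‖ ≤ t.card * r := by
      simpa using norm_sum_le_of_le t fun i hi ↦ h i (Finset.mem_insert_of_mem hi)
    -- This crude bound absorbs the cross term `a j * S`; the induction then closes because 2 + 1 ≤
    -- 4.
    have hcard : (t.card : ℝ) ≤ 4 ^ t.card := by
      exact_mod_cast (Nat.lt_pow_self (by norm_num : 1 < 4)).le
    have hsplit : (1 - a j) * P - 1 + (a j + S) = (1 - a j) * (P - 1 + S) + a j * S := by ring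
    have h1 : ‖1 - a j‖ ≤ 2 := (norm_sub_le _ _).trans (by simp; linarith)
    calc ‖(1 - a j) * P - 1 + (a j + S)‖
        ≤ ‖1 - a j‖ * ‖P - 1 + S‖ + ‖a j‖ * ‖S‖ := by
          rw [hsplit, ← norm_mul, ← norm_mul]; exact norm_add_le _ _
      _ ≤ 2 * (4 ^ t.card * r ^ 2) + r * (4 ^ t.card * r) := by gcongr; exact hS.trans (by gcongr)
      _ ≤ 4 ^ (t.card + 1) * r ^ 2 := by
          have : 0 ≤ (4 : ℝ) ^ t.card * r ^ 2 := by positivity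
          calc 2 * ((4 : ℝ) ^ t.card * r ^ 2) + r * (4 ^ t.card * r)
              = 3 * (4 ^ t.card * r ^ 2) := by ring
            _ ≤ 4 ^ (t.card + 1) * r ^ 2 := by rw [pow_succ (4 : ℝ)]; linarith

/-! ### Primes of `𝓞 ℚ` as prime numbers -/

lemma asIdeal_eq_span_natGenerator (v : HeightOneSpectrum (𝓞 ℚ)) :
    v.asIdeal = Ideal.span {(Rat.HeightOneSpectrum.natGenerator v : 𝓞 ℚ)} := by
  have h := congrArg (Ideal.map (Rat.IsIntegralClosure.intEquiv (𝓞 ℚ)).symm)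
    (Rat.HeightOneSpectrum.span_natGenerator v)
  rw [Ideal.map_span, Set.image_singleton, map_natCast, Ideal.map_symm,
    Ideal.comap_map_of_bijective _ (Rat.IsIntegralClosure.intEquiv (𝓞 ℚ)).bijective] at h
  exact h.symm

lemma absNorm_span_natCast_ringOfIntegers_rat (p : ℕ) :
    Ideal.absNorm (Ideal.span {(p : 𝓞 ℚ)}) = p := by
  rw [Ideal.absNorm_span_natCast, NumberField.RingOfIntegers.rank, Module.finrank_self, pow_one]

/-- The set of prime numbers whose residue class modulo `m` lies in `H`. -/
def natPrimesWithResidueIn {m : ℕ} (H : Subgroup (ZMod m)ˣ) : Set Nat.Primes :=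
  {p | ∃ u ∈ H, (u : ZMod m) = ((p : ℕ) : ZMod m)}

lemma absNorm_asIdeal_eq_primesEquiv (v : HeightOneSpectrum (𝓞 ℚ)) :
    Ideal.absNorm v.asIdeal = (Rat.HeightOneSpectrum.primesEquiv v : ℕ) := by
  rw [asIdeal_eq_span_natGenerator, absNorm_span_natCast_ringOfIntegers_rat]
  rfl

lemma mem_primesWithResidueIn_iff {m : ℕ} (H : Subgroup (ZMod m)ˣ)
    (v : HeightOneSpectrum (𝓞 ℚ)) :
    v ∈ primesWithResidueIn H ↔
      Rat.HeightOneSpectrum.primesEquiv v ∈ natPrimesWithResidueIn H := by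
  constructor
  · rintro ⟨p, -, hv, hu⟩
    have : (Rat.HeightOneSpectrum.primesEquiv v : ℕ) = p := by
      rw [← absNorm_asIdeal_eq_primesEquiv, hv, absNorm_span_natCast_ringOfIntegers_rat]
    simpa only [natPrimesWithResidueIn, Set.mem_ofPred_eq, this] using hu
  · exact fun hu ↦ ⟨_, (Rat.HeightOneSpectrum.primesEquiv v).2, asIdeal_eq_span_natGenerator v, hu⟩

lemma partialDedekindZeta_primesWithResidueIn {m : ℕ} (H : Subgroup (ZMod m)ˣ) (s : ℂ) :
    partialDedekindZeta (primesWithResidueIn H) s =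
      ∏' p : natPrimesWithResidueIn H, (1 - ((p : Nat.Primes) : ℂ) ^ (-s))⁻¹ := by
  rw [partialDedekindZeta, ← (Rat.HeightOneSpectrum.primesEquiv.subtypeEquiv
    (mem_primesWithResidueIn_iff H)).tprod_eq]
  refine tprod_congr fun v ↦ ?_
  rw [absNorm_asIdeal_eq_primesEquiv]
  rfl

/-! ### Characters trivial on H and the correction product -/

section Characters

variable {m : ℕ} [NeZero m] (H : Subgroup (ZMod m)ˣ)

open scoped Classical in
/-- The Dirichlet characters modulo `m` that are trivial on `H`. -/
noncomputable def charactersTrivialOn : Finset (DirichletCharacter ℂ m) :=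
  Finset.univ.filter fun χ ↦ ∀ u ∈ H, χ u = 1

variable {H} in
lemma mem_charactersTrivialOn {χ : DirichletCharacter ℂ m} :
    χ ∈ charactersTrivialOn H ↔ ∀ u ∈ H, χ u = 1 := by
  simp [charactersTrivialOn]

lemma one_mem_charactersTrivialOn : 1 ∈ charactersTrivialOn H :=
  mem_charactersTrivialOn.2 fun u _ ↦ MulChar.one_apply_coe u

/-- These characters form the kernel of restriction to H on the dual group. -/
lemma card_charactersTrivialOn : (charactersTrivialOn H).card = H.index := by
  rw [Subgroup.index, ← CommGroup.card_domRestrictHom_ker ℂ H, ← Nat.card_eq_finsetCard]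
  refine Nat.card_congr (MulChar.equivToUnitHom.subtypeEquiv fun χ ↦ ?_)
  rw [mem_charactersTrivialOn, MonoidHom.mem_ker, MonoidHom.domRestrictHom_apply,
    MonoidHom.domRestrict_eq_one_iff]
  exact forall₂_congr fun u _ ↦ by rw [Units.ext_iff, MulChar.coe_equivToUnitHom, Units.val_one]

lemma exists_mem_charactersTrivialOn_apply_ne_one {u : (ZMod m)ˣ} (hu : u ∉ H) :
    ∃ χ ∈ charactersTrivialOn H, χ u ≠ 1 := by
  rw [← CommGroup.forall_monoidHom_apply_eq_one_iff ℂ H u] at hu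
  push Not at hu
  obtain ⟨φ, hφ, hφu⟩ := hu
  refine ⟨MulChar.ofUnitHom φ, mem_charactersTrivialOn.2 fun v hv ↦ ?_, ?_⟩
  · simp [hφ v hv]
  · simpa using hφu

/-- Multiplication by a ψ in the set with ψ(a) ≠ 1 permutes the summands. At a non-unit every term
is 0, which covers the primes dividing m. -/
lemma sum_charactersTrivialOn_apply_eq_zero {a : ZMod m} (ha : ¬ ∃ u ∈ H, (u : ZMod m) = a) :
    ∑ χ ∈ charactersTrivialOn H, χ a = 0 := by
  by_cases hua : IsUnit a
  · obtain ⟨u, rfl⟩ := hua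
    obtain ⟨ψ, hψ, hψu⟩ := exists_mem_charactersTrivialOn_apply_ne_one H
      (u := u) fun hu ↦ ha ⟨u, hu, rfl⟩
    have hmul : ∑ χ ∈ charactersTrivialOn H, (ψ * χ) u = ∑ χ ∈ charactersTrivialOn H, χ u := by
      refine Finset.sum_equiv (Equiv.mulLeft ψ) (fun χ ↦ ?_) fun χ _ ↦ rfl
      simp only [mem_charactersTrivialOn, Equiv.coe_mulLeft, MulChar.mul_apply]
      refine forall₂_congr fun v hv ↦ ?_
      rw [mem_charactersTrivialOn.1 hψ v hv, one_mul]
    simp only [MulChar.mul_apply, ← Finset.mul_sum] at hmul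
    exact (mul_left_eq_self₀.1 hmul).resolve_left hψu
  · exact Finset.sum_eq_zero fun χ _ ↦ χ.map_nonunit hua

open scoped Classical in
/-- The deviation from `1` of the Euler factor at `p` of `∏ L(s, χ)⁻¹`, over the characters `χ`
trivial on `H`, if the class of `p` is not in `H`. -/
noncomputable def complementaryFactorSubOne (p : Nat.Primes) (s : ℂ) : ℂ :=
  if p ∈ natPrimesWithResidueIn H then 0
  else ∏ χ ∈ charactersTrivialOn H, (1 - χ ((p : ℕ) : ZMod m) * (p : ℂ) ^ (-s)) - 1

omit [NeZero m] in
lemma norm_character_mul_prime_cpow_le (χ : DirichletCharacter ℂ m) (p : Nat.Primes) {s : ℂ} :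
    ‖χ ((p : ℕ) : ZMod m) * (p : ℂ) ^ (-s)‖ ≤ (p : ℝ) ^ (-s.re) := by
  rw [norm_mul, Complex.norm_natCast_cpow_of_pos p.2.pos, Complex.neg_re]
  exact mul_le_of_le_one_left (by positivity) (χ.norm_le_one _)

lemma prime_rpow_neg_lt_one (p : Nat.Primes) {x : ℝ} (hx : 0 < x) : (p : ℝ) ^ (-x) < 1 :=
  Real.rpow_lt_one_of_one_lt_of_neg (by exact_mod_cast p.2.one_lt) (by linarith)

omit [NeZero m] in
lemma one_sub_character_mul_prime_cpow_ne_zero (χ : DirichletCharacter ℂ m) (p : Nat.Primes)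
    {s : ℂ} (hs : 0 < s.re) : 1 - χ ((p : ℕ) : ZMod m) * (p : ℂ) ^ (-s) ≠ 0 := by
  intro h
  have h1 := (norm_character_mul_prime_cpow_le χ p (s := s)).trans_lt (prime_rpow_neg_lt_one p hs)
  rw [← sub_eq_zero.1 h, norm_one] at h1
  exact h1.false

/-- With the linear term gone, the error is quadratic in p^(-3/4), and the exponent 3/2 > 1 makes
the sum over primes converge. -/
lemma norm_complementaryFactorSubOne_le (p : Nat.Primes) {s : ℂ} (hs : 3 / 4 < s.re) :
    ‖complementaryFactorSubOne H p s‖ ≤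
      4 ^ (charactersTrivialOn H).card * (p : ℝ) ^ (-(3 / 2) : ℝ) := by
  rw [complementaryFactorSubOne]
  split_ifs with hp
  · rw [norm_zero]; positivity
  have hp1 : (1 : ℝ) ≤ p := by exact_mod_cast p.2.one_le
  have h := norm_prod_one_sub_sub_one_add_sum_le (charactersTrivialOn H)
    (fun χ ↦ χ ((p : ℕ) : ZMod m) * (p : ℂ) ^ (-s)) (r := (p : ℝ) ^ (-(3 / 4) : ℝ))
    (by positivity) (prime_rpow_neg_lt_one p (by norm_num)).le
    fun χ _ ↦ (norm_character_mul_prime_cpow_le χ p).trans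
      (Real.rpow_le_rpow_of_exponent_le hp1 (by linarith))
  rw [← Finset.sum_mul, sum_charactersTrivialOn_apply_eq_zero H hp, zero_mul, add_zero,
    ← Real.rpow_natCast ((p : ℝ) ^ _), ← Real.rpow_mul (by positivity)] at h
  convert h using 3
  norm_num

lemma summable_bound_complementaryFactorSubOne :
    Summable fun p : Nat.Primes ↦
      (4 : ℝ) ^ (charactersTrivialOn H).card * (p : ℝ) ^ (-(3 / 2) : ℝ) :=
  (Nat.Primes.summable_rpow.2 (by norm_num)).mul_left _

lemma summable_norm_complementaryFactorSubOne {s : ℂ} (hs : 3 / 4 < s.re) :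
    Summable fun p : Nat.Primes ↦ ‖complementaryFactorSubOne H p s‖ :=
  (summable_bound_complementaryFactorSubOne H).of_nonneg_of_le (fun _ ↦ norm_nonneg _)
    fun p ↦ norm_complementaryFactorSubOne_le H p hs

lemma isOpen_three_quarters_lt_re : IsOpen {s : ℂ | 3 / 4 < s.re} :=
  isOpen_lt continuous_const Complex.continuous_re

lemma differentiable_complementaryFactorSubOne (p : Nat.Primes) :
    Differentiable ℂ (complementaryFactorSubOne H p) := by
  unfold complementaryFactorSubOne
  split_ifs
  · fun_prop
  · have : ((p : ℕ) : ℂ) ≠ 0 := by exact_mod_cast p.2.ne_zero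
    refine Differentiable.sub_const (Differentiable.fun_finsetProd fun χ _ ↦ ?_) 1
    exact (((differentiable_id.neg).const_cpow (.inl this)).const_mul _).const_sub 1

/-- The infinite product of the Euler factors of `∏ L(s, χ)⁻¹`, over the characters `χ` trivial
on `H`, at the primes whose class is not in `H`. -/
noncomputable def complementaryProduct (s : ℂ) : ℂ :=
  ∏' p : Nat.Primes, (1 + complementaryFactorSubOne H p s)

lemma differentiableOn_complementaryProduct :
    DifferentiableOn ℂ (complementaryProduct H) {s : ℂ | 3 / 4 < s.re} :=
  (Summable.hasProdLocallyUniformlyOn_one_add isOpen_three_quarters_lt_re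
    (summable_bound_complementaryFactorSubOne H)
    (.of_forall fun p _ hs ↦ norm_complementaryFactorSubOne_le H p hs)
    fun p ↦ (differentiable_complementaryFactorSubOne H p).continuous.continuousOn).differentiableOn
    (.of_forall fun _ ↦ by
      simpa [Finset.prod_fn] using DifferentiableOn.finsetProd fun p _ ↦
        ((differentiable_complementaryFactorSubOne H p).const_add 1).differentiableOn)
    isOpen_three_quarters_lt_re

lemma complementaryProduct_ne_zero {s : ℂ} (hs : 3 / 4 < s.re) : complementaryProduct H s ≠ 0 := by
  refine tprod_one_add_ne_zero_of_summable (fun p ↦ ?_)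
    (summable_norm_complementaryFactorSubOne H hs)
  rw [complementaryFactorSubOne]
  split_ifs
  · simp
  · rw [add_sub_cancel]
    exact Finset.prod_ne_zero_iff.2 fun χ _ ↦
      one_sub_character_mul_prime_cpow_ne_zero χ p (by linarith)

/-- Needed to move the |X|-th power outside the infinite product. -/
lemma multipliable_subtype_one_sub_prime_cpow_inv (B : Set Nat.Primes) {s : ℂ} (hs : 1 < s.re) :
    Multipliable fun p : B ↦ (1 - ((p : Nat.Primes) : ℂ) ^ (-s))⁻¹ := by
  have hnorm (p : Nat.Primes) : ‖-(p : ℂ) ^ (-s)‖ = (p : ℝ) ^ (-s.re) := by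
    rw [norm_neg, Complex.norm_natCast_cpow_of_pos p.2.pos, Complex.neg_re]
  have hsum : Summable fun p : B ↦ ‖-((p : Nat.Primes) : ℂ) ^ (-s)‖ := by
    simp only [hnorm]
    exact (Nat.Primes.summable_rpow.2 (by linarith)).subtype B
  -- Inverting a convergent product factor by factor requires a non-zero limit.
  have hne : ∏' p : B, (1 + -((p : Nat.Primes) : ℂ) ^ (-s)) ≠ 0 := by
    refine tprod_one_add_ne_zero_of_summable (fun p h ↦ ?_) hsum
    have h1 := (hnorm p).trans_lt (prime_rpow_neg_lt_one p (by linarith))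
    rw [← neg_eq_of_add_eq_zero_right h, norm_neg, norm_one] at h1
    exact h1.false
  simpa only [sub_eq_add_neg] using
    ((multipliable_one_add_of_summable hsum).hasProd.inv₀ hne).multipliable

lemma prod_LFunction_mul_complementaryProduct {s : ℂ} (hs : 1 < s.re) :
    (∏ χ ∈ charactersTrivialOn H, χ.LFunction s) * complementaryProduct H s =
      partialDedekindZeta (primesWithResidueIn H) s ^ (charactersTrivialOn H).card := by
  have hL : HasProd (fun p : Nat.Primes ↦ ∏ χ ∈ charactersTrivialOn H,
      (1 - χ ((p : ℕ) : ZMod m) * (p : ℂ) ^ (-s))⁻¹)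
      (∏ χ ∈ charactersTrivialOn H, χ.LFunction s) :=
    hasProd_prod fun χ _ ↦ χ.LFunction_eq_LSeries hs ▸ χ.LSeries_eulerProduct_hasProd hs
  have hG : HasProd (fun p ↦ 1 + complementaryFactorSubOne H p s) (complementaryProduct H s) :=
    (multipliable_one_add_of_summable
    (summable_norm_complementaryFactorSubOne H (s := s) (by linarith))).hasProd
  have hB : HasProd (fun p : natPrimesWithResidueIn H ↦
      (1 - ((p : Nat.Primes) : ℂ) ^ (-s))⁻¹ ^ (charactersTrivialOn H).card)
      ((∏ χ ∈ charactersTrivialOn H, χ.LFunction s) * complementaryProduct H s) := by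
    -- Extending by 1 to all primes allows a comparison prime by prime.
    refine (hasProd_subtype_iff_mulIndicator (f := fun p : Nat.Primes ↦
      (1 - (p : ℂ) ^ (-s))⁻¹ ^ (charactersTrivialOn H).card)).2 ?_
    convert hL.mul hG using 1
    ext p
    rw [complementaryFactorSubOne]
    by_cases hp : p ∈ natPrimesWithResidueIn H
    · rw [Set.mulIndicator_of_mem hp, if_pos hp, add_zero, mul_one, Finset.prod_congr rfl
        (g := fun _ ↦ (1 - (p : ℂ) ^ (-s))⁻¹), Finset.prod_const]
      obtain ⟨u, hu, hup⟩ := hp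
      intro χ hχ
      rw [← hup, mem_charactersTrivialOn.1 hχ u hu, one_mul]
    · rw [Set.mulIndicator_of_notMem hp, if_neg hp, add_sub_cancel, ← Finset.prod_mul_distrib]
      exact (Finset.prod_eq_one fun χ _ ↦ inv_mul_cancel₀
        (one_sub_character_mul_prime_cpow_ne_zero χ p (by linarith))).symm
  rw [partialDedekindZeta_primesWithResidueIn, ← hB.tprod_eq,
    (multipliable_subtype_one_sub_prime_cpow_inv _ hs).tprod_pow]

open scoped Classical in
/-- `s - 1` times the product of the `L`-functions of the characters trivial on `H` and of
`complementaryProduct H`, with the singularity at `1` removed. -/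
noncomputable def regularPart (s : ℂ) : ℂ :=
  DirichletCharacter.LFunctionTrivChar₁ m s *
    (∏ χ ∈ (charactersTrivialOn H).erase 1, χ.LFunction s) * complementaryProduct H s

lemma differentiableOn_regularPart :
    DifferentiableOn ℂ (regularPart H) {s : ℂ | 3 / 4 < s.re} :=
  ((DirichletCharacter.differentiable_LFunctionTrivChar₁ m).differentiableOn.mul
    (DifferentiableOn.fun_finsetProd fun _ hχ ↦ (DirichletCharacter.differentiable_LFunction
      (Finset.ne_of_mem_erase hχ)).differentiableOn)).mul (differentiableOn_complementaryProduct H)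

lemma regularPart_one_ne_zero : regularPart H 1 ≠ 0 :=
  mul_ne_zero (mul_ne_zero (DirichletCharacter.LFunctionTrivChar₁_apply_one_ne_zero m)
    (Finset.prod_ne_zero_iff.2 fun _ hχ ↦ DirichletCharacter.LFunction_apply_one_ne_zero
      (Finset.ne_of_mem_erase hχ)))
    (complementaryProduct_ne_zero H (by norm_num))

lemma inv_mul_regularPart {s : ℂ} (hs : 1 < s.re) :
    (s - 1)⁻¹ * regularPart H s =
      partialDedekindZeta (primesWithResidueIn H) s ^ (charactersTrivialOn H).card := by
  have hs1 : s ≠ 1 := by rintro rfl; simp at hs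
  rw [← prod_LFunction_mul_complementaryProduct H hs, regularPart,
    DirichletCharacter.LFunctionTrivChar₁, Function.update_of_ne hs1,
    ← Finset.mul_prod_erase _ _ (one_mem_charactersTrivialOn H),
    DirichletCharacter.LFunctionTrivChar]
  field_simp [sub_ne_zero.2 hs1]

end Characters

theorem corollary3 (m : ℕ) (hm : 0 < m) (H : Subgroup (ZMod m)ˣ) :
    HasPolarDensity (primesWithResidueIn H) ((Nat.card H : ℝ) / (Nat.totient m : ℝ)) := by
  have : NeZero m := ⟨hm.ne'⟩
  have hcard := H.card_mul_index
  rw [Nat.card_eq_fintype_card (α := (ZMod m)ˣ), ZMod.card_units_eq_totient] at hcard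
  have hH : (Nat.card H : ℝ) ≠ 0 := by exact_mod_cast Nat.card_pos.ne'
  have hanalytic {z : ℂ} (hz : 3 / 4 < z.re) : AnalyticAt ℂ (regularPart H) z :=
    (differentiableOn_regularPart H).analyticAt (isOpen_three_quarters_lt_re.mem_nhds hz)
  have hmero : MeromorphicOn (fun s ↦ (s - 1)⁻¹ * regularPart H s) {s : ℂ | 3 / 4 < s.re} :=
    fun z hz ↦ (MeromorphicAt.inv (by fun_prop)).mul (hanalytic hz).meromorphicAt
  have h1 : (3 / 4 : ℝ) < (1 : ℂ).re := by norm_num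
  refine ⟨(charactersTrivialOn H).card, 1,
    Finset.card_pos.2 ⟨1, one_mem_charactersTrivialOn H⟩, ?_, {s | 3 / 4 < s.re},
    fun s ↦ (s - 1)⁻¹ * regularPart H s, isOpen_three_quarters_lt_re, h1, hmero,
    fun s _ hs ↦ inv_mul_regularPart H hs, ?_⟩
  · rw [card_charactersTrivialOn, ← hcard, Nat.cast_mul, Nat.cast_one, ← div_div, div_self hH]
  · rw [meromorphicOrderAt_eq_int_iff (hmero 1 h1)]
    exact ⟨regularPart H, hanalytic h1, regularPart_one_ne_zero H, .of_forall fun s ↦ by simp⟩
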